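/- **Setting.** Let $(\alpha_n)_{n\ge 1},(\beta_n)_{n\ge 1}$ be sequences in $(0,1]$ and $(p_n)_{n\ge 1}$ a sequence of positive reals. For $i\ge 1$ let $(\mathcal X_i,K_i,\pi_i)$ be the two-state Markov chain $$\mathcal X_i=\{0,1\},\qquad K_i=\begin{pmatrix}1-\alpha_i&\alpha_i\\ \beta_i&1-\beta_i\end{pmatrix},\qquad \pi_i=\Big(\tfrac{\beta_i}{\alpha_i+\beta_i},\tfrac{\alpha_i}{\alpha_i+\beta_i}\Big).$$ For $n\ge 1$ put $q_n=p_1+\dots+p_n$, $\mathcal Y_n=\{0,1\}^n$, $\nu_n=\pi_1\times\dots\times\pi_n$ and $$L_n=\sum_{i=1}^n\frac{p_i}{q_n}\,I\otimes\cdots\otimes I\otimes K_i\otimes I\otimes\cdots\otimes I\quad(K_i\text{ in the }i\text{th position}).$$ Consider the continuous time chain with transition matrices $H_{n,t}=e^{-t(I-L_n)}$, $t\ge 0$, started at the zero vector $\mathbf 0\in\mathcal Y_n$, and set $$d_{n,\mathrm{TV}}(t)=\sup_{A\subset\mathcal Y_n}\{H_{n,t}(\mathbf 0,A)-\nu_n(A)\},\qquad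 d_{n,2}(t)=\Big(\sum_{y\in\mathcal Y_n}\Big|\frac{H_{n,t}(\mathbf 0,y)}{\nu_n(y)}-1\Big|^2\nu_n(y)\Big)^{1/2},$$ $$T_{n,\mathrm{TV}}(\epsilon)=\inf\{t\ge 0: d_{n,\mathrm{TV}}(t)\le\epsilon\},\qquad T_{n,2}(\epsilon)=\inf\{t\ge 0: d_{n,2}(t)\le\epsilon\}.$$ **Cutoffs.** Let $(d_n,M)$ be $(d_{n,\mathrm{TV}},1)$ or $(d_{n,2},\infty)$. The family has a *total variation cutoff*, respectively an *$L^2$-cutoff*, if there are $t_n>0$ such that $d_n(at_n)\to 0$ for every $a>1$ and $d_n(at_n)\to M$ for every $a\in(0,1)$, as $n\to\infty$. It has a *$(t_n,b_n)$ total variation cutoff*, respectively a *$(t_n,b_n)$ $L^2$-cutoff*, if $t_n>0$, $b_n>0$, $b_n=o(t_n)$ and $$\lim_{c\to\infty}\limsup_{n\to\infty}d_n(t_n+cb_n)=0,\qquad \lim_{c\to-\infty}\liminf_{n\to\infty}d_n(t_n+cb_n)=M.$$ **Proposition.** Assume $\sup_n \alpha_n/\beta_n<\infty$. Then: 1. The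 family has a total variation cutoff if and only if it has an $L^2$-cutoff. Furthermore, if these cutoffs exist, then $T_{n,\mathrm{TV}}(\epsilon)/T_{n,2}(\delta)\to 1$ as $n\to\infty$ for all $\epsilon\in(0,1)$ and $\delta>0$. 2. For all sequences $(t_n)$ and $(b_n)$ of reals, the family has a $(t_n,b_n)$ total variation cutoff if and only if it has a $(t_n,b_n)$ $L^2$-cutoff. -/

import Mathlib

open Filter Topology Asymptotics

noncomputable section

namespace ProductCutoff

/-! ### Finite continuous time Markov chains -/

section Chain

variable {X : Type*} [Fintype X] [DecidableEq X]

/-- The semigroup `H_t = exp (-t (I - K))` of the continuous time chain associated with a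
transition matrix `K`. -/
def semigroup (K : Matrix X X ℝ) (t : ℝ) : Matrix X X ℝ :=
  NormedSpace.exp ((-t) • (1 - K))

/-- The law at time `t` of the continuous time chain associated with `K` and started at the
state `x`, as a vector of probabilities: `δ_x H_t`. -/
def law (K : Matrix X X ℝ) (x : X) (t : ℝ) : X → ℝ :=
  Matrix.vecMul (Pi.single x 1) (semigroup K t)

/-- Total variation distance `sup_A (μ(A) - ν(A))`. -/
def tv (μ ν : X → ℝ) : ℝ :=
  ⨆ A : Finset X, (∑ y ∈ A, μ y - ∑ y ∈ A, ν y)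

/-- The `L²(π)`-distance `(∑_y |μ(y)/π(y) - 1|² π(y))^{1/2}` of `μ` from `π`. -/
def lTwo (μ π : X → ℝ) : ℝ :=
  Real.sqrt (∑ y, |μ y / π y - 1| ^ 2 * π y)

/-- Total variation distance to `π` at time `t`, started at `x`. -/
def dTV (K : Matrix X X ℝ) (π : X → ℝ) (x : X) (t : ℝ) : ℝ := tv (law K x t) π

/-- `L²`-distance to `π` at time `t`, started at `x`. -/
def dTwo (K : Matrix X X ℝ) (π : X → ℝ) (x : X) (t : ℝ) : ℝ := lTwo (law K x t) π

end Chain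

/-- The mixing time `inf {t ≥ 0 | d(t) ≤ ε}` of a distance function `d`. -/
def mixingTime (d : ℝ → ℝ) (ε : ℝ) : ℝ := sInf {t : ℝ | 0 ≤ t ∧ d t ≤ ε}

/-! ### Product chains -/

section Product

variable {ι : Type*} [Fintype ι] [DecidableEq ι] {X : ι → Type*} [∀ i, DecidableEq (X i)]

/-- The tensor product `⨂ i, A i` of a finite family of square matrices. -/
def tensor (A : ∀ i, Matrix (X i) (X i) ℝ) : Matrix (∀ i, X i) (∀ i, X i) ℝ :=
  Matrix.of fun x y => ∏ i, A i (x i) (y i)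

/-- The transition matrix `∑ i, w i • (I ⊗ ⋯ ⊗ I ⊗ K i ⊗ I ⊗ ⋯ ⊗ I)` of the product chain
according to the probability vector `w`. -/
def productMatrix (w : ι → ℝ) (K : ∀ i, Matrix (X i) (X i) ℝ) :
    Matrix (∀ i, X i) (∀ i, X i) ℝ :=
  ∑ i, w i • tensor (Function.update (fun j => (1 : Matrix (X j) (X j) ℝ)) i (K i))

/-- The product measure of the `π i`. -/
def productMeasure (π : ∀ i, X i → ℝ) : (∀ i, X i) → ℝ := fun x => ∏ i, π i (x i)

end Product

/-! ### Products of two-state chains -/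

/-- The two-state transition matrix on `{0, 1}`. -/
def twoStateK (α β : ℝ) : Matrix (Fin 2) (Fin 2) ℝ := !![1 - α, α; β, 1 - β]

/-- The stationary distribution of the two-state chain. -/
def twoStatePi (α β : ℝ) : Fin 2 → ℝ := ![β / (α + β), α / (α + β)]

/-- Given sequences `α 0, α 1, …`, `β 0, β 1, …` and `p 0, p 1, …`, the transition matrix of the
`n`-th product chain. Sequences are indexed from `0`, so the `n`-th product chain is the product of
the `n + 1` two-state chains with indices `0, …, n`, according to the probability vector
`p i / (p 0 + ⋯ + p n)`. -/
def chainK (α β p : ℕ → ℝ) (n : ℕ) : Matrix (Fin (n + 1) → Fin 2) (Fin (n + 1) → Fin 2) ℝ :=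
  productMatrix (fun i : Fin (n + 1) => p i / ∑ j : Fin (n + 1), p j)
    (fun i : Fin (n + 1) => twoStateK (α i) (β i))

/-- The stationary distribution of the `n`-th product chain. -/
def chainPi (α β : ℕ → ℝ) (n : ℕ) : (Fin (n + 1) → Fin 2) → ℝ :=
  productMeasure fun i : Fin (n + 1) => twoStatePi (α i) (β i)

/-- Total variation distance at time `t` of the `n`-th continuous time product chain, started at
the zero vector. -/
def chainTV (α β p : ℕ → ℝ) (n : ℕ) (t : ℝ) : ℝ :=
  dTV (chainK α β p n) (chainPi α β n) 0 t

/-- `L²`-distance at time `t` of the `n`-th continuous time product chain, started at the zero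
vector. -/
def chainTwo (α β p : ℕ → ℝ) (n : ℕ) (t : ℝ) : ℝ :=
  dTwo (chainK α β p n) (chainPi α β n) 0 t

/-! ### Cutoffs

`d n t` is the distance of the `n`-th chain at time `t`, and `M` is the limiting value before the
cutoff: `1` for the total variation distance and `∞` for the `L²`-distance. Limits are taken in the
extended reals, so that a `limsup` or `liminf` of an unbounded sequence has its usual meaning. -/

/-- The family presents a cutoff. -/
def HasCutoff (M : EReal) (d : ℕ → ℝ → ℝ) : Prop :=
  ∃ t : ℕ → ℝ, (∀ n, 0 < t n) ∧
    (∀ a : ℝ, 1 < a → Tendsto (fun n => (d n (a * t n) : EReal)) atTop (𝓝 0)) ∧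
    (∀ a : ℝ, 0 < a → a < 1 → Tendsto (fun n => (d n (a * t n) : EReal)) atTop (𝓝 M))

/-- The family presents a `(t_n, b_n)` cutoff. -/
def HasWindowCutoff (M : EReal) (d : ℕ → ℝ → ℝ) (t b : ℕ → ℝ) : Prop :=
  (∀ n, 0 < t n) ∧ (∀ n, 0 < b n) ∧ b =o[atTop] t ∧
    Tendsto (fun c : ℝ => limsup (fun n => (d n (t n + c * b n) : EReal)) atTop) atTop (𝓝 0) ∧
    Tendsto (fun c : ℝ => liminf (fun n => (d n (t n + c * b n) : EReal)) atTop) atBot (𝓝 M)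

end ProductCutoff

end

open ProductCutoff

/-! Write `R` for a bound on all `α n / β n`. The forward equation factorizes, so the law at time
`t` is a product of explicit two-state laws whose densities against the stationary measures are at
most `1 + R`. Both the Hellinger affinity and `1 + d ^ 2`, with `d` the `L²`-distance, are
multiplicative over products. In one factor, bounded density gives affinity at most `1 - c * χ² ≤ (1
+ χ²) ^ (-c)` with `c = 1 / (4 * (2 + R))` (`affinity_le`, `one_sub_mul_le_rpow`). Multiplying,
total variation is at least `1 - (1 + d ^ 2) ^ (-c)`, with `c` independent of `n` and `t`.

Conversely, Cauchy–Schwarz bounds total variation by `d` and by `1 - 1 / (2 + d ^ 2)`. Hence, along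
any nonnegative times, one distance tends to `0` iff the other does, and total variation tends to
`1` iff `d` tends to `∞`. The cutoff statements follow formally from these inequalities, collected
in `Comparable`; the mixing time ratio also uses that `d` decreases in time. -/

namespace ProductCutoff

/-! ### Total variation, `L²`-distance and Hellinger affinity -/

section Distances

variable {X : Type*} [Fintype X]

theorem tv_eq_one_sub_sum_min [DecidableEq X] (μ π : X → ℝ) (hμ : ∑ x, μ x = 1) :
    tv μ π = 1 - ∑ x, min (μ x) (π x) := by
  classical
  have key : ∀ A : Finset X, ∑ y ∈ A, μ y - ∑ y ∈ A, π y ≤ 1 - ∑ x, min (μ x) (π x) := by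
    intro A
    rw [← hμ, ← Finset.sum_sub_distrib, ← Finset.sum_sub_distrib]
    calc ∑ x ∈ A, (μ x - π x) ≤ ∑ x ∈ A, (μ x - min (μ x) (π x)) :=
          Finset.sum_le_sum fun x _ => by linarith [min_le_right (μ x) (π x)]
      _ ≤ ∑ x, (μ x - min (μ x) (π x)) :=
          Finset.sum_le_sum_of_subset_of_nonneg (Finset.subset_univ _)
            fun x _ _ => by linarith [min_le_left (μ x) (π x)]
  apply le_antisymm (ciSup_le key)
  refine le_trans (le_of_eq ?_) (le_ciSup (f := fun A : Finset X => ∑ y ∈ A, μ y - ∑ y ∈ A, π y)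
    ⟨_, by rintro _ ⟨A, rfl⟩; exact key A⟩ (Finset.univ.filter fun x => π x ≤ μ x))
  rw [← hμ, ← Finset.sum_sub_distrib, ← Finset.sum_sub_distrib, Finset.sum_filter]
  refine Finset.sum_congr rfl fun x _ => ?_
  split_ifs with h
  · rw [min_eq_right h]
  · rw [min_eq_left (le_of_not_ge h), sub_self]

/-- Expand the square. The right side, the second moment of the density, is what tensorizes. -/
theorem one_add_lTwo_sq {μ π : X → ℝ} (hμ : ∑ x, μ x = 1) (hπ : ∑ x, π x = 1)
    (hpos : ∀ x, 0 < π x) : 1 + lTwo μ π ^ 2 = ∑ x, μ x ^ 2 / π x := by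
  have h : ∀ x, |μ x / π x - 1| ^ 2 * π x = μ x ^ 2 / π x - 2 * μ x + π x := by
    intro x
    have := (hpos x).ne'
    rw [sq_abs]
    field_simp
    ring
  rw [lTwo, Real.sq_sqrt (Finset.sum_nonneg fun x _ => by have := hpos x; positivity)]
  simp only [h, Finset.sum_add_distrib, Finset.sum_sub_distrib, ← Finset.mul_sum, hμ, hπ]
  ring

theorem tv_le_lTwo [DecidableEq X] {μ π : X → ℝ} (hπ : ∑ x, π x = 1) (hpos : ∀ x, 0 < π x) :
    tv μ π ≤ lTwo μ π := by
  refine ciSup_le fun A => Real.le_sqrt_of_sq_le ?_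
  have h1 : ∑ y ∈ A, μ y - ∑ y ∈ A, π y = ∑ y ∈ A, (μ y - π y) := by
    rw [Finset.sum_sub_distrib]
  rw [h1]
  have h2 := Finset.sum_sq_le_sum_mul_sum_of_sq_le_mul A (r := fun y => μ y - π y)
    (f := fun y => |μ y / π y - 1| ^ 2 * π y) (g := π)
    (fun y _ => by have := hpos y; positivity) (fun y _ => (hpos y).le)
    (fun y _ => le_of_eq (by have := (hpos y).ne'; rw [sq_abs]; field_simp))
  have h3 : ∑ y ∈ A, π y ≤ 1 := hπ ▸ Finset.sum_le_sum_of_subset_of_nonneg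
    (Finset.subset_univ _) fun x _ _ => (hpos x).le
  have h4 : ∑ y ∈ A, |μ y / π y - 1| ^ 2 * π y ≤ ∑ y, |μ y / π y - 1| ^ 2 * π y :=
    Finset.sum_le_sum_of_subset_of_nonneg (Finset.subset_univ _)
      fun x _ _ => by have := hpos x; positivity
  have h5 : 0 ≤ ∑ y ∈ A, |μ y / π y - 1| ^ 2 * π y :=
    Finset.sum_nonneg fun x _ => by have := hpos x; positivity
  calc _ ≤ _ := h2
    _ ≤ (∑ y ∈ A, |μ y / π y - 1| ^ 2 * π y) * 1 := mul_le_mul_of_nonneg_left h3 h5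
    _ ≤ _ := by rw [mul_one]; exact h4

/-- Cauchy–Schwarz for `μ² = (μπ/(μ+π)) * (μ²/π + μ)`: the first factor is at most `min μ π`, and
the second sums to `2 + d ^ 2`. -/
theorem tv_le_one_sub_inv [DecidableEq X] {μ π : X → ℝ} (hμ : ∑ x, μ x = 1)
    (hπ : ∑ x, π x = 1) (hμ0 : ∀ x, 0 ≤ μ x) (hpos : ∀ x, 0 < π x) :
    tv μ π ≤ 1 - 1 / (2 + lTwo μ π ^ 2) := by
  rw [tv_eq_one_sub_sum_min μ π hμ]
  have hL := one_add_lTwo_sq hμ hπ hpos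
  have h2 := Finset.sum_sq_le_sum_mul_sum_of_sq_le_mul Finset.univ (r := μ)
    (f := fun y => μ y * π y / (μ y + π y)) (g := fun y => μ y ^ 2 / π y + μ y)
    (fun y _ => by have := hpos y; have := hμ0 y; positivity)
    (fun y _ => by have := hpos y; have := hμ0 y; positivity)
    (fun y _ => le_of_eq (by
      have h1 := hpos y
      have h2 : 0 < μ y + π y := by linarith [hμ0 y]
      field_simp))
  rw [Finset.sum_add_distrib, ← hL, hμ] at h2
  have h3 : ∑ y, μ y * π y / (μ y + π y) ≤ ∑ y, min (μ y) (π y) := by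
    refine Finset.sum_le_sum fun y _ => ?_
    have h1 := hpos y
    have h0 := hμ0 y
    have h2 : 0 < μ y + π y := by linarith
    rw [div_le_iff₀ h2]
    rcases le_total (μ y) (π y) with h | h
    · rw [min_eq_left h]; nlinarith
    · rw [min_eq_right h]; nlinarith
  have h4 : 1 / (2 + lTwo μ π ^ 2) ≤ ∑ y, μ y * π y / (μ y + π y) := by
    rw [div_le_iff₀ (by positivity)]
    nlinarith
  linarith

theorem one_sub_affinity_le_tv [DecidableEq X] {μ π : X → ℝ} (hμ : ∑ x, μ x = 1)
    (hμ0 : ∀ x, 0 ≤ μ x) (hpos : ∀ x, 0 < π x) :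
    1 - ∑ x, √(μ x * π x) ≤ tv μ π := by
  rw [tv_eq_one_sub_sum_min μ π hμ]
  have : ∑ x, min (μ x) (π x) ≤ ∑ x, √(μ x * π x) := by
    refine Finset.sum_le_sum fun x _ => Real.le_sqrt_of_sq_le ?_
    rw [sq]
    exact mul_le_mul (min_le_left _ _) (min_le_right _ _) (le_min (hμ0 x) (hpos x).le) (hμ0 x)
  linarith

/-- If `μ / π` is bounded by `1 + R`, the Hellinger affinity is controlled by the `χ²`-distance. -/
theorem affinity_le {μ π : X → ℝ} {R : ℝ} (hμ : ∑ x, μ x = 1) (hπ : ∑ x, π x = 1)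
    (hμ0 : ∀ x, 0 ≤ μ x) (hpos : ∀ x, 0 < π x) (hR : ∀ x, μ x ≤ (1 + R) * π x) (hR0 : 0 ≤ R) :
    ∑ x, √(μ x * π x) ≤ 1 - 1 / (4 * (2 + R)) * (∑ x, μ x ^ 2 / π x - 1) := by
  have h : ∀ x, √(μ x * π x) ≤
      (μ x + π x) / 2 - 1 / (4 * (2 + R)) * (μ x ^ 2 / π x - 2 * μ x + π x) := by
    intro x
    have hp := hpos x
    have e : μ x * π x = (μ x / π x) * π x ^ 2 := by field_simp
    have hf0 : 0 ≤ μ x / π x := by have := hμ0 x; positivity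
    have hf1 : μ x / π x ≤ 1 + R := by rw [div_le_iff₀ hp]; exact hR x
    obtain ⟨s, hs0, hs⟩ : ∃ s : ℝ, 0 ≤ s ∧ μ x / π x = s ^ 2 :=
      ⟨√(μ x / π x), Real.sqrt_nonneg _, (Real.sq_sqrt hf0).symm⟩
    have hm : μ x = s ^ 2 * π x := by rw [← hs]; field_simp
    rw [e, hs, Real.sqrt_mul (by positivity), Real.sqrt_sq hs0, Real.sqrt_sq hp.le]
    have e2 : μ x ^ 2 / π x - 2 * μ x + π x = π x * (s ^ 2 - 1) ^ 2 := by
      rw [hm]; field_simp; ring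
    have e3 : (μ x + π x) / 2 = s * π x + π x * (s - 1) ^ 2 / 2 := by rw [hm]; ring
    rw [hs] at hf1
    rw [e2, e3]
    -- Here `s` is the square root of the density. Since `(s + 1)² ≤ 2 * (s² + 1) ≤ 2 * (2 + R)`,
    -- the term `(s² - 1)²` is absorbed by `(s - 1)²`; this fixes the constant.
    have e4 : 1 / (4 * (2 + R)) * (s + 1) ^ 2 ≤ 1 / 2 := by
      rw [div_mul_eq_mul_div, div_le_div_iff₀ (by positivity) (by norm_num)]
      nlinarith [sq_nonneg (s - 1)]
    have e5 : 0 ≤ π x * (s - 1) ^ 2 := by positivity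
    have e6 := mul_le_mul_of_nonneg_left e4 e5
    nlinarith
  calc _ ≤ _ := Finset.sum_le_sum fun x _ => h x
    _ = _ := by
      simp only [Finset.sum_sub_distrib, Finset.sum_add_distrib, ← Finset.mul_sum,
        ← Finset.sum_div, hμ, hπ]
      ring

end Distances

/-! ### The forward equation -/

section Law

variable {X : Type*} [Fintype X] [DecidableEq X]

attribute [local instance] Matrix.linftyOpNormedRing Matrix.linftyOpNormedAlgebra in
theorem hasDerivAt_exp_smul (M : Matrix X X ℝ) (t : ℝ) (x y : X) :
    HasDerivAt (fun t : ℝ => NormedSpace.exp (t • M) x y) ((M * NormedSpace.exp (t • M)) x y) t := by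
  have h := hasDerivAt_exp_smul_const' (𝕂 := ℝ) M t
  have h1 := hasDerivAt_pi.1 h x
  exact hasDerivAt_pi.1 h1 y

/-- Uniqueness for the forward equation. -/
theorem law_eq_of_hasDerivAt (K : Matrix X X ℝ) (x : X) (g : ℝ → X → ℝ)
    (h0 : g 0 = Pi.single x 1)
    (hg : ∀ t y, HasDerivAt (fun t => g t y) (Matrix.vecMul (g t) K y - g t y) t) (t : ℝ) :
    law K x t = g t := by
  -- Undoing the semigroup along a solution gives zero derivative, hence the initial vector.
  have hconst : ∀ t, Matrix.vecMul (g t) (NormedSpace.exp (t • (1 - K))) = Pi.single x 1 := by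
    intro t
    ext y
    have hd : ∀ s, HasDerivAt (fun s => Matrix.vecMul (g s) (NormedSpace.exp (s • (1 - K))) y) 0 s := by
      intro s
      have h1 : HasDerivAt (fun s => ∑ z, g s z * NormedSpace.exp (s • (1 - K)) z y)
          (∑ z, ((Matrix.vecMul (g s) K z - g s z) * NormedSpace.exp (s • (1 - K)) z y
            + g s z * ((1 - K) * NormedSpace.exp (s • (1 - K))) z y)) s :=
        HasDerivAt.fun_sum fun z _ => (hg s z).mul (hasDerivAt_exp_smul (1 - K) s z y)
      refine h1.congr_deriv ?_
      have h2 : Matrix.vecMul (Matrix.vecMul (g s) K - g s) (NormedSpace.exp (s • (1 - K)))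
          + Matrix.vecMul (g s) ((1 - K) * NormedSpace.exp (s • (1 - K))) = 0 := by
        rw [← Matrix.vecMul_vecMul, ← Matrix.add_vecMul, Matrix.vecMul_sub, Matrix.vecMul_one]
        simp
      have h3 := congrFun h2 y
      simp only [Pi.add_apply, Matrix.vecMul, dotProduct, Pi.sub_apply, Pi.zero_apply,
        ← Finset.sum_add_distrib] at h3
      exact h3
    have h4 := is_const_of_deriv_eq_zero
      (f := fun s => Matrix.vecMul (g s) (NormedSpace.exp (s • (1 - K))) y)
      (fun s => (hd s).differentiableAt) (fun s => (hd s).deriv) t 0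
    simpa only [zero_smul, NormedSpace.exp_zero, Matrix.vecMul_one, h0] using h4
  have hinv : NormedSpace.exp (t • (1 - K)) * NormedSpace.exp ((-t) • (1 - K)) = 1 := by
    rw [← Matrix.exp_add_of_commute _ _ (((Commute.refl (1 - K)).smul_left t).smul_right (-t)),
      ← add_smul, add_neg_cancel, zero_smul, NormedSpace.exp_zero]
  rw [law, semigroup, ← hconst t, Matrix.vecMul_vecMul, hinv, Matrix.vecMul_one]

end Law

/-! ### Factorization of the law of a product chain -/

section Product

variable {ι : Type*} [Fintype ι] [DecidableEq ι] {X : ι → Type*} [∀ i, Fintype (X i)]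

theorem sum_productMeasure (f : ∀ i, X i → ℝ) : ∑ x, productMeasure f x = ∏ i, ∑ a, f i a :=
  (Fintype.prod_sum f).symm

theorem vecMul_tensor [∀ i, DecidableEq (X i)] (f : ∀ i, X i → ℝ)
    (A : ∀ i, Matrix (X i) (X i) ℝ) :
    Matrix.vecMul (productMeasure f) (tensor A) = productMeasure fun i => Matrix.vecMul (f i) (A i) := by
  ext y
  simp only [Matrix.vecMul, dotProduct, productMeasure, tensor, Matrix.of_apply,
    ← Finset.prod_mul_distrib]
  exact (Fintype.prod_sum fun i a => f i a * A i a (y i)).symm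

/-- The law of a product chain is the product of the laws of the time-changed factors. -/
theorem law_productMatrix [∀ i, DecidableEq (X i)] (w : ι → ℝ) (hw : ∑ i, w i = 1)
    (K : ∀ i, Matrix (X i) (X i) ℝ) (x : ∀ i, X i) (f : ∀ i, ℝ → X i → ℝ)
    (h0 : ∀ i, f i 0 = Pi.single (x i) 1)
    (hf : ∀ i t a, HasDerivAt (fun t => f i t a)
      (w i * (Matrix.vecMul (f i t) (K i) a - f i t a)) t) (t : ℝ) :
    law (productMatrix w K) x t = productMeasure fun i => f i t := by
  refine law_eq_of_hasDerivAt _ _ (fun t => productMeasure fun i => f i t) ?_ ?_ t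
  · ext y
    simp only [productMeasure, h0, Pi.single_apply, Finset.prod_ite_zero, Finset.prod_const_one,
      Finset.mem_univ, forall_true_left, funext_iff]
  · intro t y
    have h := HasDerivAt.fun_finsetProd (u := Finset.univ) fun i _ => hf i t (y i)
    refine h.congr_deriv ?_
    have e : ∀ i, Matrix.vecMul (productMeasure fun i => f i t)
        (tensor (Function.update (fun j => (1 : Matrix (X j) (X j) ℝ)) i (K i))) y
        = (∏ j ∈ Finset.univ.erase i, f j t (y j)) * Matrix.vecMul (f i t) (K i) (y i) := by
      intro i
      rw [vecMul_tensor, productMeasure, ← Finset.prod_erase_mul _ _ (Finset.mem_univ i)]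
      rw [Function.update_self]
      congr 1
      refine Finset.prod_congr rfl fun j hj => ?_
      rw [Function.update_of_ne (Finset.ne_of_mem_erase hj), Matrix.vecMul_one]
    -- Weights of total mass one split the loss term over the coordinates, to match the product rule
    -- term by term.
    have e2 : ∏ i, f i t (y i) = ∑ i, w i * ((∏ j ∈ Finset.univ.erase i, f j t (y j)) * f i t (y i)) := by
      simp only [Finset.prod_erase_mul _ _ (Finset.mem_univ _), ← Finset.sum_mul, hw, one_mul]
    have e3 : Matrix.vecMul (productMeasure fun i => f i t) (productMatrix w K) y
        = ∑ i, w i * ((∏ j ∈ Finset.univ.erase i, f j t (y j)) *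
          Matrix.vecMul (f i t) (K i) (y i)) := by
      simp only [← e, productMatrix, Matrix.vecMul_sum, Matrix.vecMul_smul, Finset.sum_apply,
        Pi.smul_apply, smul_eq_mul]
    symm
    rw [e3, productMeasure, e2, ← Finset.sum_sub_distrib]
    refine Finset.sum_congr rfl fun i _ => ?_
    rw [smul_eq_mul]
    ring

end Product

end ProductCutoff

namespace ProductCutoff

/-! ### Transfer of cutoffs between comparable distances -/

section Comparison

theorem ereal_tendsto_zero_iff {u : ℕ → ℝ} (hu : ∀ᶠ n in atTop, 0 ≤ u n) :
    Tendsto (fun n => (u n : EReal)) atTop (𝓝 0) ↔ ∀ ε > 0, ∀ᶠ n in atTop, u n < ε := by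
  rw [← EReal.coe_zero, EReal.tendsto_coe, Metric.tendsto_nhds]
  refine forall₂_congr fun ε _ => eventually_congr ?_
  filter_upwards [hu] with n hn
  rw [Real.dist_eq, sub_zero, abs_of_nonneg hn]

theorem ereal_tendsto_one_iff {u : ℕ → ℝ} (hu : ∀ᶠ n in atTop, u n ≤ 1) :
    Tendsto (fun n => (u n : EReal)) atTop (𝓝 1) ↔ ∀ ε > 0, ∀ᶠ n in atTop, 1 - ε < u n := by
  rw [← EReal.coe_one, EReal.tendsto_coe, Metric.tendsto_nhds]
  refine forall₂_congr fun ε _ => eventually_congr ?_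
  filter_upwards [hu] with n hn
  rw [Real.dist_eq, abs_sub_comm, abs_of_nonneg (by linarith)]
  constructor <;> intro h <;> linarith

/-- Nonnegativity is only asked eventually: for negative `c` the time `t n + c * b n` may be
negative for small `n`, where comparability is not available. -/
theorem tendsto_limsup_zero_iff {F : ℝ → ℕ → ℝ} {l : Filter ℝ}
    (h0 : ∀ c, ∀ᶠ n in atTop, 0 ≤ F c n) :
    Tendsto (fun c => limsup (fun n => (F c n : EReal)) atTop) l (𝓝 0) ↔
      ∀ ε > 0, ∀ᶠ c in l, ∀ᶠ n in atTop, F c n < ε := by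
  constructor
  · intro h ε hε
    filter_upwards [h.eventually_lt_const (EReal.coe_pos.2 hε)] with c hc
    filter_upwards [eventually_lt_of_limsup_lt hc] with n hn
    exact EReal.coe_lt_coe_iff.1 hn
  · intro h
    rw [tendsto_order]
    constructor
    · intro a ha
      refine Eventually.of_forall fun c => ha.trans_le ?_
      exact le_limsup_of_frequently_le ((h0 c).mono fun n hn => EReal.coe_nonneg.2 hn).frequently
    · intro a ha
      obtain ⟨ε, hε, hεa⟩ := EReal.lt_iff_exists_real_btwn.1 ha
      filter_upwards [h ε (EReal.coe_pos.1 hε)] with c hc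
      refine lt_of_le_of_lt (limsup_le_of_le ?_ ?_) hεa
      · isBoundedDefault
      · exact hc.mono fun n hn => EReal.coe_le_coe_iff.2 hn.le

theorem tendsto_liminf_one_iff {F : ℝ → ℕ → ℝ} {l : Filter ℝ}
    (h1 : ∀ c, ∀ᶠ n in atTop, F c n ≤ 1) :
    Tendsto (fun c => liminf (fun n => (F c n : EReal)) atTop) l (𝓝 1) ↔
      ∀ ε > 0, ∀ᶠ c in l, ∀ᶠ n in atTop, 1 - ε < F c n := by
  constructor
  · intro h ε hε
    have : ((1 - ε : ℝ) : EReal) < 1 := by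
      rw [← EReal.coe_one, EReal.coe_lt_coe_iff]; linarith
    filter_upwards [h.eventually_const_lt this] with c hc
    filter_upwards [eventually_lt_of_lt_liminf hc] with n hn
    exact EReal.coe_lt_coe_iff.1 hn
  · intro h
    rw [tendsto_order]
    constructor
    · intro a ha
      obtain ⟨b, hab, hb⟩ := EReal.lt_iff_exists_real_btwn.1 ha
      have hb1 : b < 1 := by rwa [← EReal.coe_one, EReal.coe_lt_coe_iff] at hb
      filter_upwards [h (1 - b) (by linarith)] with c hc
      refine lt_of_lt_of_le hab (le_liminf_of_le ?_ ?_)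
      · isBoundedDefault
      · exact hc.mono fun n hn => EReal.coe_le_coe_iff.2 (by linarith)
    · intro a ha
      refine Eventually.of_forall fun c => lt_of_le_of_lt ?_ ha
      refine liminf_le_of_frequently_le ((h1 c).mono fun n hn => ?_).frequently
      rw [← EReal.coe_one]; exact EReal.coe_le_coe_iff.2 hn

theorem tendsto_liminf_top_iff {F : ℝ → ℕ → ℝ} {l : Filter ℝ} :
    Tendsto (fun c => liminf (fun n => (F c n : EReal)) atTop) l (𝓝 ⊤) ↔
      ∀ C : ℝ, ∀ᶠ c in l, ∀ᶠ n in atTop, C < F c n := by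
  rw [EReal.tendsto_nhds_top_iff_real]
  constructor
  · intro h C
    filter_upwards [h C] with c hc
    filter_upwards [eventually_lt_of_lt_liminf hc] with n hn
    exact EReal.coe_lt_coe_iff.1 hn
  · intro h C
    filter_upwards [h (C + 1)] with c hc
    refine lt_of_lt_of_le (EReal.coe_lt_coe_iff.2 (lt_add_one C)) (le_liminf_of_le ?_ ?_)
    · isBoundedDefault
    · exact hc.mono fun n hn => EReal.coe_le_coe_iff.2 hn.le

/-- The bounds `v` of total variation type and `d` of `L²` type satisfy when they measure the same
distance to equilibrium of a product chain. -/
structure Comparable (c v d : ℝ) : Prop where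
  nonneg : 0 ≤ d
  le : v ≤ d
  le_one_sub : v ≤ 1 - 1 / (2 + d ^ 2)
  one_sub_le : 1 - (1 + d ^ 2) ^ (-c) ≤ v

variable {c v d : ℝ}

theorem Comparable.zero_le (h : Comparable c v d) (hc : 0 < c) : 0 ≤ v := by
  have := Real.rpow_le_one_of_one_le_of_nonpos (x := 1 + d ^ 2) (z := -c)
    (by nlinarith [sq_nonneg d]) (by linarith)
  linarith [h.one_sub_le]

theorem Comparable.le_one (h : Comparable c v d) : v ≤ 1 := by
  have : 0 ≤ 1 / (2 + d ^ 2) := by positivity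
  linarith [h.le_one_sub]

/-- The lower bound is monotone in `d`. -/
theorem Comparable.one_sub_le_of_le (h : Comparable c v d) (hc : 0 < c) {η : ℝ} (hη : 0 ≤ η)
    (hd : η ≤ d) : 1 - (1 + η ^ 2) ^ (-c) ≤ v := by
  have h1 : 1 + η ^ 2 ≤ 1 + d ^ 2 := by gcongr
  have := Real.rpow_le_rpow_of_nonpos (z := -c) (by positivity) h1 (by linarith)
  linarith [h.one_sub_le]

/-- In this and the next two lemmas the threshold does not depend on `v` and `d`, so it serves all
`n` and all times at once. -/
theorem exists_lt_of_tv_lt (hc : 0 < c) {η : ℝ} (hη : 0 < η) :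
    ∃ ε > 0, ∀ v d, Comparable c v d → v < ε → d < η := by
  refine ⟨1 - (1 + η ^ 2) ^ (-c), ?_, fun v d h hv => ?_⟩
  · have := Real.rpow_lt_one_of_one_lt_of_neg (x := 1 + η ^ 2) (z := -c)
      (by have := pow_pos hη 2; linarith) (by linarith)
    linarith
  · by_contra! hd
    linarith [h.one_sub_le_of_le hc hη.le hd]

theorem exists_lt_of_lt_tv (C : ℝ) :
    ∃ ε > 0, ∀ v d, Comparable c v d → 1 - ε < v → C < d := by
  refine ⟨1 / (2 + C ^ 2), by positivity, fun v d h hv => ?_⟩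
  by_contra! hd
  have h1 : 1 / (2 + C ^ 2) ≤ 1 / (2 + d ^ 2) := by
    have := h.nonneg
    gcongr
  linarith [h.le_one_sub]

theorem exists_lt_tv_of_lt (hc : 0 < c) {ε : ℝ} (hε : 0 < ε) :
    ∃ C : ℝ, 0 ≤ C ∧ ∀ v d, Comparable c v d → C ≤ d → 1 - ε < v := by
  have h1 : Tendsto (fun C : ℝ => (1 + C ^ 2) ^ (-c)) atTop (𝓝 0) :=
    (tendsto_rpow_neg_atTop hc).comp
      (tendsto_atTop_add_const_left _ _ (tendsto_pow_atTop two_ne_zero))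
  obtain ⟨C, hC, hC0⟩ := ((h1.eventually_lt_const hε).and (eventually_ge_atTop 0)).exists
  exact ⟨C, hC0, fun v d h hd => by linarith [h.one_sub_le_of_le hc hC0 hd]⟩

variable {V D : ℕ → ℝ → ℝ}

theorem cutoff_at_iff (hc : 0 < c) (h : ∀ n t, 0 ≤ t → Comparable c (V n t) (D n t))
    {s : ℕ → ℝ} (hs : ∀ n, 0 ≤ s n) :
    (Tendsto (fun n => (V n (s n) : EReal)) atTop (𝓝 0) ↔
      Tendsto (fun n => (D n (s n) : EReal)) atTop (𝓝 0)) ∧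
    (Tendsto (fun n => (V n (s n) : EReal)) atTop (𝓝 1) ↔
      Tendsto (fun n => (D n (s n) : EReal)) atTop (𝓝 ⊤)) := by
  have hs' := fun n => h n _ (hs n)
  rw [ereal_tendsto_zero_iff (.of_forall fun n => (hs' n).zero_le hc),
    ereal_tendsto_zero_iff (.of_forall fun n => (hs' n).nonneg),
    ereal_tendsto_one_iff (.of_forall fun n => (hs' n).le_one), EReal.tendsto_nhds_top_iff_real]
  simp only [EReal.coe_lt_coe_iff]
  refine ⟨⟨fun H η hη => ?_, fun H ε hε => ?_⟩, ⟨fun H C => ?_, fun H ε hε => ?_⟩⟩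
  · obtain ⟨ε, hε, he⟩ := exists_lt_of_tv_lt hc hη
    exact (H ε hε).mono fun n hn => he _ _ (hs' n) hn
  · exact (H ε hε).mono fun n hn => (hs' n).le.trans_lt hn
  · obtain ⟨ε, hε, he⟩ := exists_lt_of_lt_tv (c := c) C
    exact (H ε hε).mono fun n hn => he _ _ (hs' n) hn
  · obtain ⟨C, _, he⟩ := exists_lt_tv_of_lt hc hε
    exact (H C).mono fun n hn => he _ _ (hs' n) hn.le

theorem cutoff_iff (hc : 0 < c) (h : ∀ n t, 0 ≤ t → Comparable c (V n t) (D n t)) :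
    HasCutoff 1 V ↔ HasCutoff ⊤ D := by
  refine exists_congr fun t => and_congr_right fun ht => and_congr ?_ ?_
  · refine forall₂_congr fun a ha => (cutoff_at_iff hc h fun n => ?_).1
    have := ht n
    positivity
  · refine forall₃_congr fun a ha _ => (cutoff_at_iff hc h fun n => ?_).2
    have := ht n
    positivity

theorem windowCutoff_iff (hc : 0 < c) (h : ∀ n t, 0 ≤ t → Comparable c (V n t) (D n t))
    (t b : ℕ → ℝ) : HasWindowCutoff 1 V t b ↔ HasWindowCutoff ⊤ D t b := by
  refine and_congr_right fun ht => and_congr_right fun hb => and_congr_right fun hbt => ?_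
  have hs : ∀ a : ℝ, ∀ᶠ n in atTop, Comparable c (V n (t n + a * b n)) (D n (t n + a * b n)) := by
    intro a
    -- As `b = o(t)`, eventually `(|a| + 1) * b n ≤ t n`, so the time is nonnegative.
    filter_upwards [hbt.def (c := 1 / (|a| + 1)) (by positivity)] with n hn
    apply h
    rw [Real.norm_of_nonneg (hb n).le, Real.norm_of_nonneg (ht n).le, one_div,
      inv_mul_eq_div, le_div_iff₀ (by positivity)] at hn
    nlinarith [hb n, neg_abs_le a]
  rw [tendsto_limsup_zero_iff fun a => (hs a).mono fun n hn => hn.zero_le hc,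
    tendsto_limsup_zero_iff fun a => (hs a).mono fun n hn => hn.nonneg,
    tendsto_liminf_one_iff fun a => (hs a).mono fun n hn => hn.le_one, tendsto_liminf_top_iff]
  refine and_congr ⟨fun H η hη => ?_, fun H ε hε => ?_⟩ ⟨fun H C => ?_, fun H ε hε => ?_⟩
  · obtain ⟨ε, hε, he⟩ := exists_lt_of_tv_lt hc hη
    filter_upwards [H ε hε] with a ha
    filter_upwards [ha, hs a] with n hn hsn using he _ _ hsn hn
  · filter_upwards [H ε hε] with a ha
    filter_upwards [ha, hs a] with n hn hsn using hsn.le.trans_lt hn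
  · obtain ⟨ε, hε, he⟩ := exists_lt_of_lt_tv (c := c) C
    filter_upwards [H ε hε] with a ha
    filter_upwards [ha, hs a] with n hn hsn using he _ _ hsn hn
  · obtain ⟨C, _, he⟩ := exists_lt_tv_of_lt hc hε
    filter_upwards [H C] with a ha
    filter_upwards [ha, hs a] with n hn hsn using he _ _ hsn hn.le

/-- Monotonicity of `d n` is not assumed, so the lower hypothesis must cover every time up to `a * t
n`. -/
theorem tendsto_mixingTime_div {d : ℕ → ℝ → ℝ} {t : ℕ → ℝ} {ε : ℝ} (ht : ∀ n, 0 < t n)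
    (hup : ∀ a > 1, ∀ᶠ n in atTop, d n (a * t n) ≤ ε)
    (hlow : ∀ a, 0 < a → a < 1 → ∀ᶠ n in atTop, ∀ s, 0 ≤ s → s ≤ a * t n → ε < d n s) :
    Tendsto (fun n => mixingTime (d n) ε / t n) atTop (𝓝 1) := by
  have hbdd : ∀ n, BddBelow {s : ℝ | 0 ≤ s ∧ d n s ≤ ε} := fun n => ⟨0, fun s hs => hs.1⟩
  rw [tendsto_order]
  constructor
  · intro a ha
    obtain ⟨a', h1, h2⟩ := exists_between (max_lt ha zero_lt_one)
    obtain ⟨ha', h0⟩ := max_lt_iff.1 h1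
    -- The time `2 * t n` shows that the set is nonempty, without which `sInf` would take its
    -- default value.
    filter_upwards [hlow a' h0 h2, hup 2 (by norm_num)] with n hn hn2
    rw [lt_div_iff₀ (ht n)]
    refine lt_of_lt_of_le (mul_lt_mul_of_pos_right ha' (ht n))
      (le_csInf ⟨2 * t n, by have := ht n; positivity, hn2⟩ fun s hs => ?_)
    by_contra! hlt
    exact (hn s hs.1 hlt.le).not_ge hs.2
  · intro a ha
    obtain ⟨a', h1, h2⟩ := exists_between ha
    filter_upwards [hup a' h1] with n hn
    rw [div_lt_iff₀ (ht n)]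
    refine lt_of_le_of_lt (csInf_le (hbdd n) ⟨?_, hn⟩) (mul_lt_mul_of_pos_right h2 (ht n))
    have := ht n
    positivity

/-- Both mixing times are asymptotic to `t n`. Only `D` needs to be monotone: largeness of `D` at
all earlier times forces `V` close to `1` there. -/
theorem mixingTime_ratio (hc : 0 < c) (h : ∀ n t, 0 ≤ t → Comparable c (V n t) (D n t))
    (hD : ∀ n, Antitone (D n)) (hV : HasCutoff 1 V) {ε δ : ℝ} (hε : 0 < ε) (hε1 : ε < 1)
    (hδ : 0 < δ) :
    Tendsto (fun n => mixingTime (V n) ε / mixingTime (D n) δ) atTop (𝓝 1) := by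
  obtain ⟨t, ht, hgt, hlt⟩ := hV
  have hpos : ∀ a > 0, ∀ n, 0 ≤ a * t n := fun a ha n => (mul_pos ha (ht n)).le
  have hgt0 : ∀ a > 1, ∀ η > 0, ∀ᶠ n in atTop, D n (a * t n) < η := fun a ha η hη =>
    (ereal_tendsto_zero_iff (.of_forall fun n =>
      (h n _ (hpos a (by linarith) n)).nonneg)).1
        ((cutoff_at_iff hc h (hpos a (by linarith))).1.1 (hgt a ha)) η hη
  have hltop : ∀ a, 0 < a → a < 1 → ∀ C : ℝ, ∀ᶠ n in atTop,
      ∀ s, 0 ≤ s → s ≤ a * t n → C < D n s := by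
    intro a ha0 ha1 C
    have h1 := (cutoff_at_iff hc h (hpos a ha0)).2.1 (hlt a ha0 ha1)
    filter_upwards [EReal.tendsto_nhds_top_iff_real.1 h1 C] with n hn s _ hs
    exact (EReal.coe_lt_coe_iff.1 hn).trans_le (hD n hs)
  have hVt : Tendsto (fun n => mixingTime (V n) ε / t n) atTop (𝓝 1) := by
    refine tendsto_mixingTime_div ht (fun a ha => ?_) fun a ha0 ha1 => ?_
    · filter_upwards [hgt0 a ha ε hε] with n hn
      exact (h n _ (hpos a (by linarith) n)).le.trans hn.le
    · obtain ⟨C, _, he⟩ := exists_lt_tv_of_lt hc (sub_pos.2 hε1)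
      filter_upwards [hltop a ha0 ha1 C] with n hn s hs0 hs
      have := he _ _ (h n s hs0) (hn s hs0 hs).le
      linarith
  have hDt : Tendsto (fun n => mixingTime (D n) δ / t n) atTop (𝓝 1) :=
    tendsto_mixingTime_div ht (fun a ha => (hgt0 a ha δ hδ).mono fun n hn => hn.le)
      fun a ha0 ha1 => hltop a ha0 ha1 δ
  have := hVt.div hDt one_ne_zero
  rw [div_one] at this
  refine this.congr fun n => ?_
  simp only [Pi.div_apply]
  rw [div_div_div_cancel_right₀ (ht n).ne']

end Comparison

end ProductCutoff

namespace ProductCutoff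

/-! ### Comparison of distances for product measures -/

section ProductDistances

variable {ι : Type*} [Fintype ι] {X : ι → Type*} [∀ i, Fintype (X i)]

theorem one_add_lTwo_sq_productMeasure [DecidableEq ι] {μ π : ∀ i, X i → ℝ}
    (hμ : ∀ i, ∑ a, μ i a = 1) (hπ : ∀ i, ∑ a, π i a = 1) (hpos : ∀ i a, 0 < π i a) :
    1 + lTwo (productMeasure μ) (productMeasure π) ^ 2 = ∏ i, ∑ a, μ i a ^ 2 / π i a := by
  rw [one_add_lTwo_sq, Fintype.prod_sum]
  · simp only [productMeasure, Finset.prod_div_distrib, Finset.prod_pow]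
  · simp only [sum_productMeasure, hμ, Finset.prod_const_one]
  · simp only [sum_productMeasure, hπ, Finset.prod_const_one]
  · exact fun x => Finset.prod_pos fun i _ => hpos i _

/-- Chain `log (1 + x) ≤ x` with `1 + y ≤ exp y` at `y = -c * log (1 + x)`. -/
theorem one_sub_mul_le_rpow {c x : ℝ} (hc : 0 ≤ c) (hx : 0 ≤ x) :
    1 - c * x ≤ (1 + x) ^ (-c) := by
  rw [Real.rpow_def_of_pos (by linarith)]
  have h1 := Real.log_le_sub_one_of_pos (x := 1 + x) (by linarith)
  have h2 := Real.add_one_le_exp (Real.log (1 + x) * -c)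
  nlinarith

/-- Total variation and `L²` distances between product measures are comparable when the densities
are bounded and the factors of the affinity are controlled. -/
theorem comparable_productMeasure [DecidableEq ι] [∀ i, DecidableEq (X i)] {μ π : ∀ i, X i → ℝ}
    {R : ℝ} (hμ : ∀ i, ∑ a, μ i a = 1) (hπ : ∀ i, ∑ a, π i a = 1) (hμ0 : ∀ i a, 0 ≤ μ i a)
    (hpos : ∀ i a, 0 < π i a) (hR : ∀ i a, μ i a ≤ (1 + R) * π i a) (hR0 : 0 ≤ R) :
    Comparable (1 / (4 * (2 + R))) (tv (productMeasure μ) (productMeasure π))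
      (lTwo (productMeasure μ) (productMeasure π)) := by
  have hμ' : ∑ x, productMeasure μ x = 1 := by
    simp only [sum_productMeasure, hμ, Finset.prod_const_one]
  have hπ' : ∑ x, productMeasure π x = 1 := by
    simp only [sum_productMeasure, hπ, Finset.prod_const_one]
  have hμ0' : ∀ x, 0 ≤ productMeasure μ x := fun x => Finset.prod_nonneg fun i _ => hμ0 i _
  have hpos' : ∀ x, 0 < productMeasure π x := fun x => Finset.prod_pos fun i _ => hpos i _
  refine ⟨Real.sqrt_nonneg _, tv_le_lTwo hπ' hpos', tv_le_one_sub_inv hμ' hπ' hμ0' hpos', ?_⟩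
  refine le_trans ?_ (one_sub_affinity_le_tv hμ' hμ0' hpos')
  have haff : ∑ x, √(productMeasure μ x * productMeasure π x) = ∏ i, ∑ a, √(μ i a * π i a) := by
    rw [Fintype.prod_sum]
    refine Finset.sum_congr rfl fun x _ => ?_
    rw [productMeasure, productMeasure, ← Finset.prod_mul_distrib,
      Real.sqrt_prod _ fun i _ => mul_nonneg (hμ0 i _) (hpos i _).le]
  have hge : ∀ i, 1 ≤ ∑ a, μ i a ^ 2 / π i a := fun i => by
    rw [← one_add_lTwo_sq (hμ i) (hπ i) (hpos i)]
    nlinarith [sq_nonneg (lTwo (μ i) (π i))]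
  rw [haff, one_add_lTwo_sq_productMeasure hμ hπ hpos,
    ← Real.finsetProd_rpow _ _ fun i _ => zero_le_one.trans (hge i)]
  refine sub_le_sub_left (Finset.prod_le_prod (fun i _ => Finset.sum_nonneg fun a _ =>
    Real.sqrt_nonneg _) fun i _ => ?_) _
  refine (affinity_le (hμ i) (hπ i) (hμ0 i) (hpos i) (hR i) hR0).trans ?_
  have := one_sub_mul_le_rpow (c := 1 / (4 * (2 + R))) (by positivity) (sub_nonneg.2 (hge i))
  rwa [add_sub_cancel] at this

end ProductDistances

/-! ### The two-state chain -/

section TwoState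

/-- The law at time `t` of the two-state chain run at speed `w` and started at `0`. -/
noncomputable def twoStateLaw (α β w t : ℝ) : Fin 2 → ℝ :=
  ![(β + α * Real.exp (-(w * (α + β) * t))) / (α + β),
    α * (1 - Real.exp (-(w * (α + β) * t))) / (α + β)]

variable {α β w t : ℝ}

theorem twoStateLaw_zero (hα : 0 < α) (hβ : 0 < β) : twoStateLaw α β w 0 = Pi.single 0 1 := by
  have : α + β ≠ 0 := by positivity
  ext a
  fin_cases a
  · simp [twoStateLaw, add_comm β α, this]
  · simp [twoStateLaw]

theorem hasDerivAt_twoStateLaw (hα : 0 < α) (hβ : 0 < β) (a : Fin 2) :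
    HasDerivAt (fun t => twoStateLaw α β w t a)
      (w * (Matrix.vecMul (twoStateLaw α β w t) (twoStateK α β) a - twoStateLaw α β w t a)) t := by
  have h0 : α + β ≠ 0 := by positivity
  have he : HasDerivAt (fun t => Real.exp (-(w * (α + β) * t)))
      (Real.exp (-(w * (α + β) * t)) * (-(w * (α + β) * 1))) t :=
    (((hasDerivAt_id t).const_mul (w * (α + β))).neg).exp
  fin_cases a
  · refine (((he.const_mul α).const_add β).div_const (α + β)).congr_deriv ?_
    simp [twoStateLaw, twoStateK, Matrix.vecMul, dotProduct, Fin.sum_univ_two]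
    field_simp
    ring
  · refine (((he.const_sub 1).const_mul α).div_const (α + β)).congr_deriv ?_
    simp [twoStateLaw, twoStateK, Matrix.vecMul, dotProduct, Fin.sum_univ_two]
    field_simp
    ring

theorem sum_twoStateLaw (hα : 0 < α) (hβ : 0 < β) : ∑ a, twoStateLaw α β w t a = 1 := by
  have h0 : α + β ≠ 0 := by positivity
  simp [twoStateLaw, Fin.sum_univ_two]
  field_simp
  ring

theorem sum_twoStatePi (hα : 0 < α) (hβ : 0 < β) : ∑ a, twoStatePi α β a = 1 := by
  have h0 : α + β ≠ 0 := by positivity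
  simp [twoStatePi, Fin.sum_univ_two]
  field_simp
  ring

theorem twoStatePi_pos (hα : 0 < α) (hβ : 0 < β) (a : Fin 2) : 0 < twoStatePi α β a := by
  fin_cases a <;> simp [twoStatePi] <;> positivity

theorem exp_neg_rate_le_one (hα : 0 < α) (hβ : 0 < β) (hw : 0 ≤ w) (ht : 0 ≤ t) :
    Real.exp (-(w * (α + β) * t)) ≤ 1 := by
  rw [Real.exp_le_one_iff, neg_nonpos]
  positivity

theorem twoStateLaw_nonneg (hα : 0 < α) (hβ : 0 < β) (hw : 0 ≤ w) (ht : 0 ≤ t) (a : Fin 2) :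
    0 ≤ twoStateLaw α β w t a := by
  have he := sub_nonneg.2 (exp_neg_rate_le_one hα hβ hw ht)
  fin_cases a <;> simp only [twoStateLaw, Fin.zero_eta, Fin.mk_one, Matrix.cons_val_zero,
    Matrix.cons_val_one] <;> positivity

/-- With `e` the exponential, the density is `1 + (α / β) * e` at `0` and `1 - e` at `1`. Starting
at `0` is why bounding `α / β` suffices. -/
theorem twoStateLaw_le (hα : 0 < α) (hβ : 0 < β) (hw : 0 ≤ w) (ht : 0 ≤ t) {R : ℝ}
    (hR : α / β ≤ R) (a : Fin 2) : twoStateLaw α β w t a ≤ (1 + R) * twoStatePi α β a := by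
  have he := exp_neg_rate_le_one hα hβ hw ht
  have he0 := Real.exp_pos (-(w * (α + β) * t))
  have hR0 : 0 < R := lt_of_lt_of_le (by positivity) hR
  rw [div_le_iff₀ hβ] at hR
  fin_cases a <;> simp only [twoStateLaw, twoStatePi, Fin.zero_eta, Fin.mk_one,
    Matrix.cons_val_zero, Matrix.cons_val_one, ← mul_div_assoc] <;>
    refine div_le_div_of_nonneg_right ?_ (by positivity) <;> nlinarith

theorem sum_twoStateLaw_sq_div (hα : 0 < α) (hβ : 0 < β) :
    ∑ a, twoStateLaw α β w t a ^ 2 / twoStatePi α β a =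
      1 + α / β * Real.exp (-(w * (α + β) * t)) ^ 2 := by
  have h0 : α + β ≠ 0 := by positivity
  simp only [twoStateLaw, twoStatePi, Fin.sum_univ_two, Matrix.cons_val_zero, Matrix.cons_val_one]
  field_simp
  ring

end TwoState

/-! ### Application to the product chains -/

section Chain

variable {α β p : ℕ → ℝ}

theorem law_chainK (hα : ∀ n, 0 < α n) (hβ : ∀ n, 0 < β n) (hp : ∀ n, 0 < p n) (n : ℕ) (t : ℝ) :
    law (chainK α β p n) 0 t = productMeasure fun i : Fin (n + 1) =>
      twoStateLaw (α i) (β i) (p i / ∑ j : Fin (n + 1), p j) t := by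
  have hq : ∑ j : Fin (n + 1), p j ≠ 0 :=
    (Finset.sum_pos (fun (j : Fin (n + 1)) _ => hp j) Finset.univ_nonempty).ne'
  refine law_productMatrix (ι := Fin (n + 1)) (X := fun _ => Fin 2)
    (fun i : Fin (n + 1) => p i / ∑ j : Fin (n + 1), p j) ?_ _ _
    (fun (i : Fin (n + 1)) => twoStateLaw (α i) (β i) (p i / ∑ j : Fin (n + 1), p j))
    (fun i => twoStateLaw_zero (hα i) (hβ i))
    (fun i _ a => hasDerivAt_twoStateLaw (hα i) (hβ i) a) t
  exact (Finset.sum_div Finset.univ (fun i : Fin (n + 1) => p i) _).symm.trans (div_self hq)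

theorem weight_nonneg (hp : ∀ n, 0 < p n) (n : ℕ) (i : Fin (n + 1)) :
    0 ≤ p i / ∑ j : Fin (n + 1), p j :=
  div_nonneg (hp i).le (Finset.sum_nonneg fun j _ => (hp j).le)

theorem comparable_chain (hα : ∀ n, 0 < α n) (hβ : ∀ n, 0 < β n) (hp : ∀ n, 0 < p n) {R : ℝ}
    (hR : ∀ n, α n / β n ≤ R) (n : ℕ) (t : ℝ) (ht : 0 ≤ t) :
    Comparable (1 / (4 * (2 + R))) (chainTV α β p n t) (chainTwo α β p n t) := by
  rw [chainTV, chainTwo, dTV, dTwo, law_chainK hα hβ hp]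
  exact comparable_productMeasure (fun i => sum_twoStateLaw (hα i) (hβ i))
    (fun i => sum_twoStatePi (hα i) (hβ i))
    (fun i => twoStateLaw_nonneg (hα i) (hβ i) (weight_nonneg hp n i) ht)
    (fun i => twoStatePi_pos (hα i) (hβ i))
    (fun i => twoStateLaw_le (hα i) (hβ i) (weight_nonneg hp n i) ht (hR i))
    ((div_pos (hα 0) (hβ 0)).le.trans (hR 0))

/-- Read off from the explicit product for `1 + d ^ 2`, each factor of which decreases in time. -/
theorem antitone_chainTwo (hα : ∀ n, 0 < α n) (hβ : ∀ n, 0 < β n) (hp : ∀ n, 0 < p n) (n : ℕ) :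
    Antitone (chainTwo α β p n) := by
  intro s t hst
  have h : ∀ t, 1 + chainTwo α β p n t ^ 2 = ∏ i : Fin (n + 1), (1 + α i / β i *
      Real.exp (-((p i / ∑ j : Fin (n + 1), p j) * (α i + β i) * t)) ^ 2) := by
    intro t
    rw [chainTwo, dTwo, law_chainK hα hβ hp, chainPi, one_add_lTwo_sq_productMeasure
      (fun i : Fin (n + 1) => sum_twoStateLaw (hα i) (hβ i))
      (fun i : Fin (n + 1) => sum_twoStatePi (hα i) (hβ i))
      (fun i : Fin (n + 1) => twoStatePi_pos (hα i) (hβ i))]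
    exact Finset.prod_congr rfl fun i _ => sum_twoStateLaw_sq_div (hα i) (hβ i)
  have hle : 1 + chainTwo α β p n t ^ 2 ≤ 1 + chainTwo α β p n s ^ 2 := by
    rw [h, h]
    refine Finset.prod_le_prod (fun i _ => ?_) fun i _ => ?_
    · have := div_pos (hα i) (hβ i)
      positivity
    · have h1 := (div_pos (hα i) (hβ i)).le
      have h2 : 0 ≤ (p i / ∑ j : Fin (n + 1), p j) * (α i + β i) :=
        mul_nonneg (weight_nonneg hp n i) (add_pos (hα i) (hβ i)).le
      gcongr
  have h0 : 0 ≤ chainTwo α β p n s := Real.sqrt_nonneg _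
  exact (abs_le_of_sq_le_sq' (by linarith) h0).2

end Chain

end ProductCutoff

theorem proposition5p3 (α β p : ℕ → ℝ)
    (hα : ∀ n, 0 < α n ∧ α n ≤ 1) (hβ : ∀ n, 0 < β n ∧ β n ≤ 1) (hp : ∀ n, 0 < p n)
    (hr : BddAbove (Set.range fun n => α n / β n)) :
    ((HasCutoff 1 (chainTV α β p) ↔ HasCutoff ⊤ (chainTwo α β p)) ∧
      (HasCutoff 1 (chainTV α β p) → ∀ ε δ : ℝ, 0 < ε → ε < 1 → 0 < δ →
        Tendsto (fun n => mixingTime (chainTV α β p n) ε / mixingTime (chainTwo α β p n) δ)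
          atTop (𝓝 1))) ∧
    (∀ t b : ℕ → ℝ,
      HasWindowCutoff 1 (chainTV α β p) t b ↔ HasWindowCutoff ⊤ (chainTwo α β p) t b) := by
  obtain ⟨R, hR⟩ := hr
  replace hR : ∀ n, α n / β n ≤ R := fun n => hR ⟨n, rfl⟩
  have hR0 : 0 < R := (div_pos (hα 0).1 (hβ 0).1).trans_le (hR 0)
  have hc : 0 < 1 / (4 * (2 + R)) := by positivity
  have h := comparable_chain (fun n => (hα n).1) (fun n => (hβ n).1) hp hR
  exact ⟨⟨cutoff_iff hc h, fun hV ε δ hε hε1 hδ => mixingTime_ratio hc h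
    (antitone_chainTwo (fun n => (hα n).1) (fun n => (hβ n).1) hp) hV hε hε1 hδ⟩,
    windowCutoff_iff hc h⟩
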